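/- Let $(X,\mu)$ be a complete $\sigma$-finite measure space with $L^2(X)$ separable, let $(Y,\nu)$ be a $\sigma$-finite measure space, let $\mathcal H$ be a separable complex Hilbert space and let $I$ be a countable set. Let $\{g_t\}_{t\in Y}\subset L^\infty(X)$ be a Parseval determining set for $L^1(X)$: for every $f\in L^1(X)$ the function $t\mapsto\int_X f\,\overline{g_t}\,d\mu$ is measurable on $Y$ and $$\int_Y\Big|\int_X f\,\overline{g_t}\,d\mu\Big|^2d\nu(t)=\int_X|f|^2\,d\mu$$ (both sides possibly infinite). Let $\mathcal F\colon L^2(X)\to L^2(Y)$ be the unique linear isometry with $(\mathcal Ff)(t)=\int_X f\,\overline{g_t}\,d\mu$ for $f\in L^1(X)\cap L^2(X)$ (the Plancherel transform), and let $\mathcal F_I\colon L^2(X;\ell^2(I))\to L^2(Y\times I)$ be the isometry which applies $\mathcal F$ to each coordinate, where $I$ carries counting measure. A system $\{u_s\}_{s\in M}$ in a Hilbert space $\mathcal K$, indexed by a measure space $(M,m)$, is Bessel if $s\mapsto\langle v,u_s\rangle$ is measurable for every $v\in\mathcal K$ and, for some $B>0$, $\int_M|\langle v,u_s\rangle|^2dm(s)\le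 B\|v\|^2$ for every $v\in\mathcal K$. Its analysis operator is $T\colon\mathcal K\to L^2(M)$, $(Tv)(s)=\langle v,u_s\rangle$; its frame operator is $T^*T$ and its Gramian is $TT^*$. For a range function $J$ on $X$ (a choice of closed subspaces $J(x)$ of a separable Hilbert space), called measurable if $x\mapsto\langle P_{J(x)}u,v\rangle$ is measurable for all $u,v$, let $V_J$ be the space of square-integrable $\psi$ with $\psi(x)\in J(x)$ for a.e. $x$. A range operator $R\colon J\to J'$ is a choice of bounded linear maps $R(x)\colon J(x)\to J'(x)$; it is bounded if $\operatorname{ess\,sup}_x\|R(x)\|<\infty$, and measurable if $x\mapsto\langle R(x)P_{J(x)}u,v\rangle$ is measurable for all $u,v$. In that case $\int_X^\oplus R(x)\,d\mu(x)\colon V_J\to V_{J'}$ is the operator $\psi\mapsto(x\mapsto R(x)[\psi(x)])$. A closed subspace of a vector-valued $L^2$ space over $X$ is multiplication invariant (MI) if it is invariant under multiplication by every $f\in L^\infty(X)$, and a bounded operator between MI spaces is MI if it commutes with these multiplications. Let $\mathscr A=\{\varphi_i\}_{i\in I}\subset L^2(X;\mathcal H)$, let $S(\mathscr A)$ be the closed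 linear span of $\{g_t\varphi_i: t\in Y,\ i\in I\}$, and assume that $E(\mathscr A)=\{g_t\varphi_i\}_{(t,i)\in Y\times I}$ is a Bessel system in $S(\mathscr A)$, with analysis operator $T\colon S(\mathscr A)\to L^2(Y\times I)$. Put $J(x)=\overline{\operatorname{span}}\{\varphi_i(x): i\in I\}$. Then $J$ is a measurable range function with $S(\mathscr A)=V_J$; for a.e. $x$ the sequence $\{\varphi_i(x)\}_{i\in I}$ is Bessel in $J(x)$; and, with $\tilde T(x)\colon J(x)\to\ell^2(I)$ its analysis operator and $S(x)=\tilde T(x)^*\tilde T(x)$ its frame operator (all set to be $0$ on the exceptional null set), $\tilde T(x)$, $S(x)$ and $\tilde T(x)\tilde T(x)^*$ define bounded measurable range operators. Moreover: 1. $T$ maps into the image of $\mathcal F_I$, and $T=\mathcal F_I\int_X^\oplus\tilde T(x)\,d\mu(x)$. 2. The frame operator $S=T^*T\colon S(\mathscr A)\to S(\mathscr A)$ of $E(\mathscr A)$ is an MI operator, and $S=\int_X^\oplus S(x)\,d\mu(x)$. 3. $\mathcal F_I^*(TT^*)\mathcal F_I$ is an MI operator on $L^2(X;\ell^2(I))$,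 and $\mathcal F_I^*(TT^*)\mathcal F_I=\int_X^\oplus\tilde T(x)\tilde T(x)^*\,d\mu(x)$. -/

import Mathlib

open MeasureTheory Filter Topology
open scoped ENNReal InnerProductSpace InnerProduct ComplexConjugate lp

noncomputable section

namespace MIFrames

/-! ### Auxiliary facts on `L²` norms -/

section Aux

variable {M E : Type*} [MeasurableSpace M] {m : Measure M} [NormedAddCommGroup E]

lemma eLpNorm_two_sq (f : M → E) : eLpNorm f 2 m ^ 2 = ∫⁻ s, ‖f s‖ₑ ^ 2 ∂m := by
  have h := eLpNorm_nnreal_pow_eq_lintegral (f := f) (μ := m) (p := 2) (by norm_num)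
  simpa using h

lemma enorm_sq_eq_lintegral (f : Lp E 2 m) : ‖f‖ₑ ^ 2 = ∫⁻ s, ‖f s‖ₑ ^ 2 ∂m := by
  rw [Lp.enorm_def, eLpNorm_two_sq]

lemma memLp_two_of_lintegral {f : M → E} (hf : AEStronglyMeasurable f m)
    (h : ∫⁻ s, ‖f s‖ₑ ^ 2 ∂m < ⊤) : MemLp f 2 m := by
  refine ⟨hf, ?_⟩
  rw [← eLpNorm_two_sq] at h
  exact ENNReal.pow_lt_top_iff.1 h |>.resolve_right (by norm_num)

lemma enorm_toLp_sq {f : M → E} (hf : MemLp f 2 m) :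
    ‖hf.toLp f‖ₑ ^ 2 = ∫⁻ s, ‖f s‖ₑ ^ 2 ∂m := by
  rw [Lp.enorm_toLp, eLpNorm_two_sq]

lemma norm_eq_of_enorm_sq_eq {F G : Type*} [NormedAddCommGroup F] [NormedAddCommGroup G]
    {a : F} {b : G} (h : ‖a‖ₑ ^ 2 = ‖b‖ₑ ^ 2) : ‖a‖ = ‖b‖ := by
  have h' : ‖a‖ₑ = ‖b‖ₑ := by
    have := (ENNReal.pow_right_strictMono (n := 2) (by norm_num)).injective
    exact this h
  rw [← toReal_enorm a, ← toReal_enorm b, h']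

lemma norm_le_sqrt_mul {F G : Type*} [NormedAddCommGroup F] [NormedAddCommGroup G]
    {a : F} {b : G} {B : ℝ} (hB : 0 < B) (h : ‖a‖ₑ ^ 2 ≤ ENNReal.ofReal (B * ‖b‖ ^ 2)) :
    ‖a‖ ≤ √B * ‖b‖ := by
  have h1 : ‖a‖ ^ 2 ≤ B * ‖b‖ ^ 2 := by
    rw [← ofReal_norm, ← ENNReal.ofReal_pow (norm_nonneg _)] at h
    exact (ENNReal.ofReal_le_ofReal_iff (by positivity)).1 h
  apply le_of_sq_le_sq _ (by positivity)
  rw [mul_pow, Real.sq_sqrt hB.le]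
  exact h1

end Aux

/-! ### Bessel systems over a measure space -/

section Bessel

variable {M K : Type*} [MeasurableSpace M] [NormedAddCommGroup K] [InnerProductSpace ℂ K]

/-- The system `{u_s}` is Bessel with bound `B`. The pairing `⟨v, u_s⟩`, linear in `v`, is
`inner ℂ (u s) v` in Mathlib's convention. -/
def IsBesselWith (B : ℝ) (m : Measure M) (u : M → K) : Prop :=
  (∀ v : K, Measurable fun s => inner ℂ (u s) v) ∧
    ∀ v : K, ∫⁻ s, ‖inner ℂ (u s) v‖ₑ ^ 2 ∂m ≤ ENNReal.ofReal (B * ‖v‖ ^ 2)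

/-- The system `{u_s}` is Bessel. -/
def IsBessel (m : Measure M) (u : M → K) : Prop :=
  ∃ B : ℝ, 0 < B ∧ IsBesselWith B m u

variable {m : Measure M} {u : M → K}

lemma IsBessel.memLp (h : IsBessel m u) (v : K) : MemLp (fun s => inner ℂ (u s) v) 2 m := by
  obtain ⟨B, -, h1, h2⟩ := h
  exact memLp_two_of_lintegral (h1 v).aestronglyMeasurable
    ((h2 v).trans_lt ENNReal.ofReal_lt_top)

/-- The analysis operator `T : K → L²(M)`, `(T v)(s) = ⟨v, u_s⟩`, of a Bessel system. -/
def IsBessel.analysis (h : IsBessel m u) : K →L[ℂ] Lp ℂ 2 m :=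
  LinearMap.mkContinuousOfExistsBound
    { toFun := fun v => (h.memLp v).toLp
      map_add' := fun v w => by
        rw [← MemLp.toLp_add]
        exact MemLp.toLp_congr _ _ (.of_forall fun s => by simp)
      map_smul' := fun c v => by
        rw [RingHom.id_apply, ← MemLp.toLp_const_smul]
        exact MemLp.toLp_congr _ _ (.of_forall fun s => by simp) }
    (by
      obtain ⟨B, hB, -, h2⟩ := id h
      refine ⟨√B, fun v => norm_le_sqrt_mul hB ?_⟩
      simp only [LinearMap.coe_mk, AddHom.coe_mk]
      rw [enorm_toLp_sq]
      exact h2 v)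

lemma IsBessel.analysis_ae (h : IsBessel m u) (v : K) :
    h.analysis v =ᵐ[m] fun s => inner ℂ (u s) v :=
  (h.memLp v).coeFn_toLp

/-- The synthesis operator `T*`. -/
def IsBessel.synthesis [CompleteSpace K] (h : IsBessel m u) : Lp ℂ 2 m →L[ℂ] K :=
  h.analysis.adjoint

/-- The frame operator `T* T`. -/
def IsBessel.frameOp [CompleteSpace K] (h : IsBessel m u) : K →L[ℂ] K :=
  h.synthesis ∘L h.analysis

/-- The Gramian `T T*`. -/
def IsBessel.gramian [CompleteSpace K] (h : IsBessel m u) : Lp ℂ 2 m →L[ℂ] Lp ℂ 2 m :=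
  h.analysis ∘L h.synthesis

end Bessel

/-! ### Discrete Bessel sequences, with analysis operator into `ℓ²(I)` -/

section Discrete

variable {I K : Type*} [MeasurableSpace I] [DiscreteMeasurableSpace I]
  [NormedAddCommGroup K] [InnerProductSpace ℂ K] {u : I → K}

lemma lp_enorm_sq {I : Type*} (a : ℓ²(I, ℂ)) : ‖a‖ₑ ^ 2 = ∑' i, ‖a i‖ₑ ^ 2 := by
  have h := lp.hasSum_norm (p := 2) (by norm_num) a
  simp only [ENNReal.toReal_ofNat, Real.rpow_ofNat] at h
  rw [← ofReal_norm, ← ENNReal.ofReal_pow (norm_nonneg _), ← h.tsum_eq,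
    ENNReal.ofReal_tsum_of_nonneg (fun _ => by positivity) h.summable]
  exact tsum_congr fun i => by
    rw [ENNReal.ofReal_pow (norm_nonneg _), ofReal_norm]

lemma IsBessel.memℓp (h : IsBessel (Measure.count : Measure I) u) (v : K) :
    Memℓp (fun i => inner ℂ (u i) v) 2 := by
  obtain ⟨B, -, -, h2⟩ := h
  have h3 := (h2 v).trans_lt ENNReal.ofReal_lt_top
  rw [lintegral_count] at h3
  refine memℓp_gen ?_
  have h4 := ENNReal.summable_toReal h3.ne
  refine h4.congr fun i => ?_
  simp

/-- The analysis operator `K → ℓ²(I)`, `v ↦ {⟨v, u_i⟩}_i`, of a Bessel sequence. -/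
def IsBessel.seqAnalysis (h : IsBessel (Measure.count : Measure I) u) : K →L[ℂ] ℓ²(I, ℂ) :=
  LinearMap.mkContinuousOfExistsBound
    { toFun := fun v => ⟨fun i => inner ℂ (u i) v, h.memℓp v⟩
      map_add' := fun v w => by
        ext i
        exact inner_add_right _ _ _
      map_smul' := fun c v => by
        ext i
        exact inner_smul_right _ _ _ }
    (by
      obtain ⟨B, hB, -, h2⟩ := id h
      refine ⟨√B, fun v => norm_le_sqrt_mul hB ?_⟩
      rw [lp_enorm_sq, ← lintegral_count]
      exact h2 v)

@[simp] lemma IsBessel.seqAnalysis_apply (h : IsBessel (Measure.count : Measure I) u) (v : K)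
    (i : I) : h.seqAnalysis v i = inner ℂ (u i) v := rfl

instance {I : Type*} [Countable I] : TopologicalSpace.SeparableSpace ℓ²(I, ℂ) := by
  let b : HilbertBasis I ℂ ℓ²(I, ℂ) := HilbertBasis.ofRepr (LinearIsometryEquiv.refl ℂ _)
  have h1 : TopologicalSpace.IsSeparable (Set.range b) := (Set.countable_range b).isSeparable
  have h2 := (h1.span (R := ℂ)).closure
  have h3 : closure (Submodule.span ℂ (Set.range b) : Set ℓ²(I, ℂ)) = Set.univ := by
    rw [← Submodule.topologicalClosure_coe, b.dense_span, Submodule.top_coe]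
  rw [h3] at h2
  exact TopologicalSpace.isSeparable_univ_iff.1 h2

end Discrete

/-! ### Range functions, range operators and their direct integrals -/

section Range

variable {X H H' : Type*} [MeasurableSpace X] (μ : Measure X)
  [NormedAddCommGroup H] [InnerProductSpace ℂ H] [NormedAddCommGroup H'] [InnerProductSpace ℂ H']

/-- A range function `J` (a choice of closed subspaces, closedness being recorded by
`CompleteSpace (J x)`) is measurable when `x ↦ ⟨P_J(x) u, v⟩` is measurable for all `u`, `v`. -/
def IsMeasurableRange (J : X → Submodule ℂ H) [∀ x, CompleteSpace (J x)] : Prop :=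
  ∀ u v : H, Measurable fun x => inner ℂ v ((J x).orthogonalProjectionOnto u : H)

/-- The space `V_J` of all `φ ∈ L²(X; H)` with `φ(x) ∈ J(x)` for a.e. `x`. -/
def rangeSpace (J : X → Submodule ℂ H) : Submodule ℂ (Lp H 2 μ) where
  carrier := {φ | ∀ᵐ x ∂μ, φ x ∈ J x}
  add_mem' := fun {φ ψ} hφ hψ => by
    filter_upwards [hφ, hψ, Lp.coeFn_add φ ψ] with x h1 h2 h3
    rw [h3]
    exact (J x).add_mem h1 h2
  zero_mem' := by
    filter_upwards [Lp.coeFn_zero H 2 μ] with x h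
    rw [h]
    exact (J x).zero_mem
  smul_mem' := fun c φ hφ => by
    filter_upwards [hφ, Lp.coeFn_smul c φ] with x h1 h2
    rw [h2]
    exact (J x).smul_mem c h1

variable {J : X → Submodule ℂ H} {J' : X → Submodule ℂ H'}

/-- A range operator `R : J → J'` is bounded when `ess sup ‖R(x)‖ < ∞`, and measurable when
`x ↦ ⟨R(x) P_J(x) u, v⟩` is measurable for all `u`, `v`. -/
structure IsBoundedMeasurable [∀ x, CompleteSpace (J x)] (R : ∀ x, J x →L[ℂ] J' x) : Prop where
  bounded : essSup (fun x => ‖R x‖ₑ) μ < ⊤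
  measurable : ∀ (u : H) (v : H'),
    Measurable fun x => inner ℂ v (R x ((J x).orthogonalProjectionOnto u) : H')

lemma exists_countable_hilbertBasis (H : Type*) [NormedAddCommGroup H] [InnerProductSpace ℂ H]
    [CompleteSpace H] [TopologicalSpace.SeparableSpace H] :
    ∃ (w : Set H) (_ : Countable w), Nonempty (HilbertBasis w ℂ H) := by
  obtain ⟨w, b, hb⟩ := exists_hilbertBasis ℂ H
  refine ⟨w, ?_, ⟨b⟩⟩
  have ho : Orthonormal ℂ ((↑) : w → H) := hb ▸ b.orthonormal
  refine Set.PairwiseDisjoint.countable_of_isOpen (s := fun v : H => Metric.ball v (1 / 2))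
    (fun v hv v' hv' hne => ?_) (fun _ _ => Metric.isOpen_ball)
    (fun v _ => ⟨v, Metric.mem_ball_self (by norm_num)⟩)
  refine Metric.ball_disjoint_ball ?_
  have h0 : inner ℂ v v' = 0 :=
    ho.2 (i := ⟨v, hv⟩) (j := ⟨v', hv'⟩) fun h => hne (congrArg Subtype.val h)
  have h1 : ‖v‖ = 1 := ho.1 ⟨v, hv⟩
  have h2 : ‖v'‖ = 1 := ho.1 ⟨v', hv'⟩
  have h3 := norm_sub_sq (𝕜 := ℂ) v v'
  rw [h0, h1, h2] at h3
  rw [dist_eq_norm]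
  norm_num at h3 ⊢
  nlinarith [norm_nonneg (v - v')]

/-- Weakly measurable functions into a separable Hilbert space are strongly measurable. -/
lemma stronglyMeasurable_of_weakly [CompleteSpace H] [TopologicalSpace.SeparableSpace H]
    {f : X → H} (hf : ∀ v : H, Measurable fun x => inner ℂ v (f x)) : StronglyMeasurable f := by
  obtain ⟨w, hw, ⟨b⟩⟩ := exists_countable_hilbertBasis H
  refine stronglyMeasurable_of_tendsto (f := fun (s : Finset w) x => ∑ i ∈ s, inner ℂ (b i) (f x) • b i)
    atTop (fun s => ?_) ?_
  · exact Finset.stronglyMeasurable_fun_sum _ fun i _ =>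
      (hf (b i)).stronglyMeasurable.smul_const _
  · refine tendsto_pi_nhds.2 fun x => ?_
    have := b.hasSum_repr (f x)
    simp only [b.repr_apply_apply] at this
    exact this

/-- A weakly measurable field of operators applied to a strongly measurable function. -/
lemma stronglyMeasurable_apply [CompleteSpace H] [TopologicalSpace.SeparableSpace H]
    [CompleteSpace H'] [TopologicalSpace.SeparableSpace H'] {A : X → H →L[ℂ] H'}
    (hA : ∀ (u : H) (v : H'), Measurable fun x => inner ℂ v (A x u))
    {f : X → H} (hf : StronglyMeasurable f) : StronglyMeasurable fun x => A x (f x) := by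
  obtain ⟨w, hw, ⟨b⟩⟩ := exists_countable_hilbertBasis H
  have hA' : ∀ u, StronglyMeasurable fun x => A x u := fun u =>
    stronglyMeasurable_of_weakly (hA u)
  refine stronglyMeasurable_of_tendsto
    (f := fun (s : Finset w) x => ∑ i ∈ s, inner ℂ (b i) (f x) • A x (b i)) atTop (fun s => ?_) ?_
  · exact Finset.stronglyMeasurable_fun_sum _ fun i _ =>
      (stronglyMeasurable_const.inner hf).smul (hA' _)
  · refine tendsto_pi_nhds.2 fun x => ?_
    have := (b.hasSum_repr (f x)).mapL (A x)
    simp only [b.repr_apply_apply, map_smul] at this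
    exact this

variable {μ}

lemma IsBoundedMeasurable.memLp [CompleteSpace H] [TopologicalSpace.SeparableSpace H]
    [CompleteSpace H'] [TopologicalSpace.SeparableSpace H'] [∀ x, CompleteSpace (J x)]
    {R : ∀ x, J x →L[ℂ] J' x} (hR : IsBoundedMeasurable μ R) (φ : Lp H 2 μ) :
    MemLp (fun x => (R x ((J x).orthogonalProjectionOnto (φ x)) : H')) 2 μ := by
  refine MemLp.of_le_mul (Lp.memLp φ) (c := (essSup (fun x => ‖R x‖ₑ) μ).toReal) ?_ ?_
  · exact (stronglyMeasurable_apply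
      (A := fun x => (J' x).subtypeL ∘L R x ∘L (J x).orthogonalProjectionOnto)
      hR.measurable (Lp.stronglyMeasurable φ)).aestronglyMeasurable
  · filter_upwards [ENNReal.ae_le_essSup (fun x => ‖R x‖ₑ)] with x hx
    have h1 : ‖R x‖ ≤ (essSup (fun x => ‖R x‖ₑ) μ).toReal := 
      (toReal_enorm (R x)).symm.trans_le (ENNReal.toReal_mono hR.bounded.ne hx)
    calc ‖(R x ((J x).orthogonalProjectionOnto (φ x)) : H')‖
        ≤ ‖R x‖ * ‖(J x).orthogonalProjectionOnto (φ x)‖ := (R x).le_opNorm _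
      _ ≤ _ := mul_le_mul h1 ((J x).norm_orthogonalProjectionOnto_apply_le _)
          (norm_nonneg _) ENNReal.toReal_nonneg

lemma IsBoundedMeasurable.toLp_mem [CompleteSpace H] [TopologicalSpace.SeparableSpace H]
    [CompleteSpace H'] [TopologicalSpace.SeparableSpace H'] [∀ x, CompleteSpace (J x)]
    {R : ∀ x, J x →L[ℂ] J' x} (hR : IsBoundedMeasurable μ R) (φ : Lp H 2 μ) :
    ((hR.memLp φ).toLp _ : Lp H' 2 μ) ∈ rangeSpace μ J' := by
  change ∀ᵐ x ∂μ, ((hR.memLp φ).toLp _ : X → H') x ∈ J' x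
  filter_upwards [(hR.memLp φ).coeFn_toLp] with x hx
  rw [hx]
  exact Submodule.coe_mem _

/-- The direct integral `∫^⊕ R(x) dμ(x) : V_J → V_{J'}` of a bounded, measurable range operator,
`φ ↦ (x ↦ R(x)[φ(x)])`. The projection onto `J(x)` only serves to regard `φ(x)`, which lies in
`J(x)` for a.e. `x`, as an element of `J(x)`; see `directIntegral_ae`. -/
def directIntegral [CompleteSpace H] [TopologicalSpace.SeparableSpace H]
    [CompleteSpace H'] [TopologicalSpace.SeparableSpace H'] [∀ x, CompleteSpace (J x)]
    (R : ∀ x, J x →L[ℂ] J' x) (hR : IsBoundedMeasurable μ R) :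
    rangeSpace μ J →L[ℂ] rangeSpace μ J' :=
  LinearMap.mkContinuousOfExistsBound
    { toFun := fun φ => ⟨(hR.memLp φ).toLp, hR.toLp_mem φ⟩
      map_add' := fun φ ψ => Subtype.ext <| by
        refine Eq.trans (MemLp.toLp_congr (hR.memLp (φ + ψ : Lp H 2 μ)) ((hR.memLp φ).add (hR.memLp ψ)) ?_)
          (MemLp.toLp_add (hR.memLp φ) (hR.memLp ψ))
        filter_upwards [Lp.coeFn_add (φ : Lp H 2 μ) ψ] with x hx
        simp only [hx, Pi.add_apply, map_add, Submodule.coe_add]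
      map_smul' := fun c φ => Subtype.ext <| by
        refine Eq.trans (MemLp.toLp_congr (hR.memLp (c • φ : Lp H 2 μ)) ((hR.memLp φ).const_smul c) ?_)
          (MemLp.toLp_const_smul c (hR.memLp φ))
        filter_upwards [Lp.coeFn_smul c (φ : Lp H 2 μ)] with x hx
        simp only [hx, Pi.smul_apply, map_smul, Submodule.coe_smul] }
    (by
      refine ⟨(essSup (fun x => ‖R x‖ₑ) μ).toReal, fun φ => ?_⟩
      change ‖(hR.memLp φ).toLp _‖ ≤ _ * ‖(φ : Lp H 2 μ)‖
      refine Lp.norm_le_mul_norm_of_ae_le_mul ?_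
      filter_upwards [ENNReal.ae_le_essSup (fun x => ‖R x‖ₑ), (hR.memLp φ).coeFn_toLp] with x hx h2
      have h1 : ‖R x‖ ≤ (essSup (fun x => ‖R x‖ₑ) μ).toReal := 
        (toReal_enorm (R x)).symm.trans_le (ENNReal.toReal_mono hR.bounded.ne hx)
      rw [h2]
      calc ‖(R x ((J x).orthogonalProjectionOnto ((φ : Lp H 2 μ) x)) : H')‖
          ≤ ‖R x‖ * ‖(J x).orthogonalProjectionOnto ((φ : Lp H 2 μ) x)‖ := (R x).le_opNorm _
        _ ≤ _ := mul_le_mul h1 ((J x).norm_orthogonalProjectionOnto_apply_le _)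
            (norm_nonneg _) ENNReal.toReal_nonneg)

lemma directIntegral_ae [CompleteSpace H] [TopologicalSpace.SeparableSpace H]
    [CompleteSpace H'] [TopologicalSpace.SeparableSpace H'] [∀ x, CompleteSpace (J x)]
    (R : ∀ x, J x →L[ℂ] J' x) (hR : IsBoundedMeasurable μ R) (φ : rangeSpace μ J) :
    ∀ᵐ x ∂μ, ∃ h : (φ : Lp H 2 μ) x ∈ J x,
      (directIntegral R hR φ : Lp H' 2 μ) x = R x ⟨(φ : Lp H 2 μ) x, h⟩ := by
  filter_upwards [(hR.memLp φ).coeFn_toLp, φ.2] with x hx hJ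
  refine ⟨hJ, ?_⟩
  change ((hR.memLp φ).toLp _ : X → H') x = _
  rw [hx]
  congr 2
  exact Submodule.orthogonalProjectionOnto_mem_subspace_eq_self (K := J x) ⟨_, hJ⟩

end Range

/-! ### Multiplication-invariant spaces and operators -/

section MI

variable {X H H' : Type*} [MeasurableSpace X] {μ : Measure X}
  [NormedAddCommGroup H] [InnerProductSpace ℂ H] [NormedAddCommGroup H'] [InnerProductSpace ℂ H']

/-- A closed subspace `V ⊆ L²(X; H)` invariant under every multiplication operator
`M_f ψ = f ψ`, `f ∈ L^∞(X)`. -/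
structure IsMISpace (V : Submodule ℂ (Lp H 2 μ)) : Prop where
  isClosed : IsClosed (V : Set (Lp H 2 μ))
  smul_mem : ∀ (f : Lp ℂ ∞ μ) (ψ : Lp H 2 μ), ψ ∈ V → (f • ψ : Lp H 2 μ) ∈ V

/-- A bounded operator `T : V → V'` between MI spaces with `T M_f = M_f T` for all
`f ∈ L^∞(X)`. -/
structure IsMIOperator {V : Submodule ℂ (Lp H 2 μ)} {V' : Submodule ℂ (Lp H' 2 μ)}
    (T : V →L[ℂ] V') : Prop where
  source : IsMISpace V
  target : IsMISpace V'
  commutes : ∀ (f : Lp ℂ ∞ μ) (ψ : V),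
    (T ⟨f • (ψ : Lp H 2 μ), source.smul_mem f ψ ψ.2⟩ : Lp H' 2 μ) = f • (T ψ : Lp H' 2 μ)

end MI

/-! ### Parseval determining sets and the Plancherel transform -/

section Plancherel

variable {X Y : Type*} [MeasurableSpace X] [MeasurableSpace Y] {μ : Measure X} {ν : Measure Y}

/-- The family `{g_t}_{t ∈ Y}` in `L^∞(X)` is a Parseval determining set for `L¹(X)`. In the second
condition both sides may be infinite. -/
structure IsParsevalDeterminingSet (μ : Measure X) (ν : Measure Y) (g : Y → Lp ℂ ∞ μ) : Prop where
  measurable : ∀ f : X → ℂ, Integrable f μ → Measurable fun t => ∫ x, f x * conj (g t x) ∂μ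
  parseval : ∀ f : X → ℂ, Integrable f μ →
    ∫⁻ t, ‖∫ x, f x * conj (g t x) ∂μ‖ₑ ^ 2 ∂ν = ∫⁻ x, ‖f x‖ₑ ^ 2 ∂μ

/-- `L¹(X) ∩ L²(X)` as a subspace of `L²(X)`. -/
def integrableL2 (μ : Measure X) : Submodule ℂ (Lp ℂ 2 μ) where
  carrier := {f | Integrable f μ}
  add_mem' := fun {f g} hf hg => (integrable_congr (Lp.coeFn_add f g)).2 (Integrable.add hf hg)
  zero_mem' := (integrable_congr (Lp.coeFn_zero ℂ 2 μ)).2 (integrable_zero X ℂ μ)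
  smul_mem' := fun c f hf => (integrable_congr (Lp.coeFn_smul c f)).2 (Integrable.smul c hf)

lemma dense_integrableL2 : Dense (integrableL2 μ : Set (Lp ℂ 2 μ)) := by
  refine (Lp.simpleFunc.dense (E := ℂ) (μ := μ) (p := 2) (by norm_num)).mono fun f hf => ?_
  have h1 := Lp.simpleFunc.memLp ⟨f, hf⟩
  have h2 := (SimpleFunc.memLp_iff_integrable (by norm_num) (by norm_num)).1 h1
  exact (integrable_congr (Lp.simpleFunc.toSimpleFunc_eq_toFun ⟨f, hf⟩)).1 h2

lemma integrable_mul_conj {f : X → ℂ} (hf : Integrable f μ) (h : Lp ℂ ∞ μ) :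
    Integrable (fun x => f x * conj (h x)) μ := by
  have h1 : MemLp (fun x => conj (h x)) ∞ μ := (Lp.memLp h).star
  exact hf.mul_of_top_left h1

variable {g : Y → Lp ℂ ∞ μ}

lemma IsParsevalDeterminingSet.memLp (hg : IsParsevalDeterminingSet μ ν g)
    (f : integrableL2 μ) :
    MemLp (fun t => ∫ x, (f : Lp ℂ 2 μ) x * conj (g t x) ∂μ) 2 ν := by
  refine memLp_two_of_lintegral (hg.measurable _ f.2).aestronglyMeasurable ?_
  rw [hg.parseval _ f.2, ← enorm_sq_eq_lintegral]
  exact ENNReal.pow_lt_top enorm_lt_top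

/-- There is a unique linear isometry `L²(X) → L²(Y)` given on `L¹(X) ∩ L²(X)` by
`f ↦ (t ↦ ∫ f conj(g_t) dμ)`. -/
theorem IsParsevalDeterminingSet.existsUnique_isometry (hg : IsParsevalDeterminingSet μ ν g) :
    ∃! F : Lp ℂ 2 μ →ₗᵢ[ℂ] Lp ℂ 2 ν, ∀ f : Lp ℂ 2 μ, Integrable f μ →
      F f =ᵐ[ν] fun t => ∫ x, f x * conj (g t x) ∂μ := by
  let F₀ : integrableL2 μ →ₗ[ℂ] Lp ℂ 2 ν :=
    { toFun := fun f => (hg.memLp f).toLp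
      map_add' := fun f f' => by
        rw [← MemLp.toLp_add]
        refine MemLp.toLp_congr _ _ (.of_forall fun t => ?_)
        simp only [Pi.add_apply]
        rw [← integral_add (integrable_mul_conj f.2 _) (integrable_mul_conj f'.2 _)]
        refine integral_congr_ae ?_
        filter_upwards [Lp.coeFn_add (f : Lp ℂ 2 μ) f'] with x hx
        simp only [Submodule.coe_add, hx, Pi.add_apply, add_mul]
      map_smul' := fun c f => by
        rw [RingHom.id_apply, ← MemLp.toLp_const_smul]
        refine MemLp.toLp_congr _ _ (.of_forall fun t => ?_)
        simp only [Pi.smul_apply, smul_eq_mul]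
        rw [← integral_const_mul]
        refine integral_congr_ae ?_
        filter_upwards [Lp.coeFn_smul c (f : Lp ℂ 2 μ)] with x hx
        simp only [Submodule.coe_smul, hx, Pi.smul_apply, smul_eq_mul, mul_assoc] }
  have hF₀ : ∀ f, ‖F₀ f‖ = ‖f‖ := fun f => by
    change ‖F₀ f‖ = ‖(f : Lp ℂ 2 μ)‖
    refine norm_eq_of_enorm_sq_eq ?_
    rw [enorm_sq_eq_lintegral (f : Lp ℂ 2 μ), ← hg.parseval _ f.2]
    exact enorm_toLp_sq (hg.memLp f)
  have hd : DenseRange (integrableL2 μ).subtype := by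
    simpa [DenseRange] using dense_integrableL2 (μ := μ)
  have hb : ∃ C, ∀ f, ‖F₀ f‖ ≤ C * ‖(integrableL2 μ).subtype f‖ :=
    ⟨1, fun f => by rw [hF₀, one_mul]; rfl⟩
  have hext : ∀ f : integrableL2 μ, F₀.extendOfNorm (integrableL2 μ).subtype f = F₀ f :=
    fun f => LinearMap.extendOfNorm_eq hd hb f
  have hn : ∀ f, ‖F₀.extendOfNorm (integrableL2 μ).subtype f‖ = ‖f‖ := fun f => by
    refine hd.induction_on (p := fun f => ‖F₀.extendOfNorm (integrableL2 μ).subtype f‖ = ‖f‖) f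
      (isClosed_eq (by fun_prop) (by fun_prop)) fun f => ?_
    exact (congrArg norm (hext f)).trans (hF₀ f)
  refine ⟨⟨(F₀.extendOfNorm (integrableL2 μ).subtype).toLinearMap, hn⟩, fun f hf => ?_,
    fun F hF => ?_⟩
  · have h1 := hext ⟨f, hf⟩
    change F₀.extendOfNorm (integrableL2 μ).subtype f =ᵐ[ν] _
    rw [h1]
    exact (hg.memLp ⟨f, hf⟩).coeFn_toLp
  · refine LinearIsometry.ext fun f => ?_
    refine hd.induction_on (p := fun f => F f = F₀.extendOfNorm (integrableL2 μ).subtype f) f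
      (isClosed_eq F.continuous (by fun_prop)) fun f => ?_
    refine Eq.trans (Lp.ext ?_) (hext f).symm
    exact (hF f f.2).trans (hg.memLp f).coeFn_toLp.symm

/-- The Plancherel transform `F : L²(X) → L²(Y)` of a Parseval determining set: the unique linear
isometry extending `(F f)(t) = ∫ f conj(g_t) dμ`, `f ∈ L¹(X) ∩ L²(X)`. -/
def IsParsevalDeterminingSet.plancherel (hg : IsParsevalDeterminingSet μ ν g) :
    Lp ℂ 2 μ →ₗᵢ[ℂ] Lp ℂ 2 ν :=
  hg.existsUnique_isometry.choose

lemma IsParsevalDeterminingSet.plancherel_ae (hg : IsParsevalDeterminingSet μ ν g)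
    (f : Lp ℂ 2 μ) (hf : Integrable f μ) :
    hg.plancherel f =ᵐ[ν] fun t => ∫ x, f x * conj (g t x) ∂μ :=
  hg.existsUnique_isometry.choose_spec.1 f hf

variable {I : Type*}

/-- The `i`-th coordinate `x ↦ [φ(x)]_i` in `L²(X)` of `φ ∈ L²(X; ℓ²(I))`. -/
def coord (i : I) : Lp ℓ²(I, ℂ) 2 μ →L[ℂ] Lp ℂ 2 μ :=
  (lp.evalCLM ℂ (fun _ : I => ℂ) 2 i).compLpL 2 μ

lemma coord_ae (i : I) (φ : Lp ℓ²(I, ℂ) 2 μ) : coord i φ =ᵐ[μ] fun x => φ x i :=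
  ContinuousLinearMap.coeFn_compLpL _ _

lemma tsum_coord [Countable I] (φ : Lp ℓ²(I, ℂ) 2 μ) : ∑' i, ‖coord i φ‖ₑ ^ 2 = ‖φ‖ₑ ^ 2 := by
  simp_rw [enorm_sq_eq_lintegral]
  rw [← lintegral_tsum fun i => by
    exact ((Lp.stronglyMeasurable (coord i φ)).enorm.pow_const 2).aemeasurable]
  refine lintegral_congr_ae ?_
  filter_upwards [ae_all_iff.2 fun i => coord_ae i φ] with x hx
  rw [lp_enorm_sq]
  exact tsum_congr fun i => by rw [hx i]

variable [Countable I] [MeasurableSpace I]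

lemma ae_prod_count {p : Y × I → Prop} (h : ∀ i, ∀ᵐ t ∂ν, p (t, i)) :
    ∀ᵐ z ∂(ν.prod (Measure.count : Measure I)), p z := by
  have h1 : ∀ᵐ t ∂ν, ∀ i, p (t, i) := ae_all_iff.2 h
  have h2 := Measure.quasiMeasurePreserving_fst (μ := ν) (ν := (Measure.count : Measure I)) |>.ae h1
  filter_upwards [h2] with z hz
  exact hz z.2

variable [DiscreteMeasurableSpace I]

lemma lintegral_prod_count [SFinite ν] {f : Y × I → ℝ≥0∞} (hf : Measurable f) :
    ∫⁻ z, f z ∂(ν.prod (Measure.count : Measure I)) = ∑' i, ∫⁻ t, f (t, i) ∂ν := by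
  rw [lintegral_prod_symm _ hf.aemeasurable, lintegral_count]

lemma stronglyMeasurable_family (F : I → Lp ℂ 2 ν) :
    StronglyMeasurable fun z : Y × I => F z.2 z.1 :=
  (measurable_from_prod_countable_left fun i =>
    (Lp.stronglyMeasurable (F i)).measurable).stronglyMeasurable

lemma lintegral_family [SFinite ν] (hg : IsParsevalDeterminingSet μ ν g) (φ : Lp ℓ²(I, ℂ) 2 μ) :
    ∫⁻ z, ‖hg.plancherel (coord z.2 φ) z.1‖ₑ ^ 2 ∂(ν.prod (Measure.count : Measure I)) =
      ‖φ‖ₑ ^ 2 := by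
  rw [lintegral_prod_count
    ((stronglyMeasurable_family fun i => hg.plancherel (coord i φ)).enorm.pow_const 2),
    ← tsum_coord]
  refine tsum_congr fun i => ?_
  rw [← enorm_sq_eq_lintegral (hg.plancherel (coord i φ))]
  rw [← ofReal_norm, ← ofReal_norm, LinearIsometry.norm_map]

lemma memLp_family [SFinite ν] (hg : IsParsevalDeterminingSet μ ν g) (φ : Lp ℓ²(I, ℂ) 2 μ) :
    MemLp (fun z : Y × I => hg.plancherel (coord z.2 φ) z.1) 2
      (ν.prod (Measure.count : Measure I)) := by
  refine memLp_two_of_lintegral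
    (stronglyMeasurable_family fun i => hg.plancherel (coord i φ)).aestronglyMeasurable ?_
  rw [lintegral_family]
  exact ENNReal.pow_lt_top enorm_lt_top

/-- The transform `F_I : L²(X; ℓ²(I)) → L²(Y × I)` applying the Plancherel transform to every
coordinate, `(F_I φ)(t, i) = (F φ_i)(t)`. -/
def IsParsevalDeterminingSet.plancherelI [SFinite ν] (hg : IsParsevalDeterminingSet μ ν g) (I : Type*)
    [Countable I] [MeasurableSpace I] [DiscreteMeasurableSpace I] :
    Lp ℓ²(I, ℂ) 2 μ →ₗᵢ[ℂ] Lp ℂ 2 (ν.prod (Measure.count : Measure I)) where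
  toFun φ := (memLp_family hg φ).toLp
  map_add' φ ψ := by
    rw [← MemLp.toLp_add]
    refine MemLp.toLp_congr (memLp_family hg (φ + ψ)) _ (ae_prod_count fun i => ?_)
    simp only [map_add, Pi.add_apply]
    exact Lp.coeFn_add _ _
  map_smul' c φ := by
    rw [RingHom.id_apply, ← MemLp.toLp_const_smul]
    refine MemLp.toLp_congr (memLp_family hg (c • φ)) _ (ae_prod_count fun i => ?_)
    simp only [map_smul, Pi.smul_apply]
    exact Lp.coeFn_smul _ _
  norm_map' φ := by
    refine norm_eq_of_enorm_sq_eq ?_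
    rw [← lintegral_family hg φ]
    exact enorm_toLp_sq (memLp_family hg φ)

lemma IsParsevalDeterminingSet.plancherelI_ae [SFinite ν] (hg : IsParsevalDeterminingSet μ ν g)
    (φ : Lp ℓ²(I, ℂ) 2 μ) :
    hg.plancherelI I φ =ᵐ[ν.prod (Measure.count : Measure I)]
      fun z => hg.plancherel (coord z.2 φ) z.1 :=
  (memLp_family hg φ).coeFn_toLp

end Plancherel

/-! ### Systems of multiplications and their fibers -/

section Systems

variable {X Y I H : Type*} [MeasurableSpace X] {μ : Measure X}
  [NormedAddCommGroup H] [InnerProductSpace ℂ H]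

/-- The generated space `S(A)`: the closed linear span of all `M_{g_t} φ_i`. -/
abbrev genSpace (g : Y → Lp ℂ ∞ μ) (φ : I → Lp H 2 μ) : Submodule ℂ (Lp H 2 μ) :=
  (Submodule.span ℂ (Set.range fun z : Y × I => (g z.1 • φ z.2 : Lp H 2 μ))).topologicalClosure

/-- The system of multiplications `E(A) = {M_{g_t} φ_i}_{(t,i)}`, as a system in `S(A)`. -/
def multSystem (g : Y → Lp ℂ ∞ μ) (φ : I → Lp H 2 μ) (z : Y × I) : genSpace g φ :=
  ⟨g z.1 • φ z.2, Submodule.le_topologicalClosure _ (Submodule.subset_span ⟨z, rfl⟩)⟩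

/-- The range function `J(x)`, the closed linear span of `{φ_i(x)}_i`. -/
abbrev genRange (φ : I → Lp H 2 μ) (x : X) : Submodule ℂ H :=
  (Submodule.span ℂ (Set.range fun i => φ i x)).topologicalClosure

/-- The fiber system `{φ_i(x)}_i`, as a system in `J(x)`. -/
def fiberSystem (φ : I → Lp H 2 μ) (x : X) (i : I) : genRange φ x :=
  ⟨φ i x, Submodule.le_topologicalClosure _ (Submodule.subset_span ⟨i, rfl⟩)⟩

/-- The range function with the constant value `H`. -/
abbrev fullRange (X H : Type*) [NormedAddCommGroup H] [InnerProductSpace ℂ H] :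
    X → Submodule ℂ H :=
  fun _ => ⊤

lemma mem_rangeSpace_fullRange (ψ : Lp H 2 μ) : ψ ∈ rangeSpace μ (fullRange X H) :=
  show ∀ᵐ x ∂μ, ψ x ∈ (⊤ : Submodule ℂ H) from Eventually.of_forall fun _ => Submodule.mem_top

instance [CompleteSpace H] (x : X) : CompleteSpace (fullRange X H x) :=
  (isClosed_univ (X := H)).completeSpace_coe

variable [MeasurableSpace I] [DiscreteMeasurableSpace I] [CompleteSpace H]

open Classical in
/-- The analysis operator `T̃(x) : J(x) → ℓ²(I)` of `{φ_i(x)}_i`, as a range operator; it is set to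
`0` at those `x` for which `{φ_i(x)}_i` is not Bessel. -/
def fiberAnalysis (φ : I → Lp H 2 μ) (x : X) : genRange φ x →L[ℂ] fullRange X ℓ²(I, ℂ) x :=
  if h : IsBessel (Measure.count : Measure I) (fiberSystem φ x) then
    h.seqAnalysis.codRestrict ⊤ fun _ => Submodule.mem_top
  else 0

/-- The frame operator `S(x) = T̃(x)* T̃(x)` of `{φ_i(x)}_i`. -/
def fiberFrameOp (φ : I → Lp H 2 μ) (x : X) : genRange φ x →L[ℂ] genRange φ x :=
  (fiberAnalysis φ x).adjoint ∘L fiberAnalysis φ x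

/-- The Gramian `T̃(x) T̃(x)*` of `{φ_i(x)}_i`. -/
def fiberGramian (φ : I → Lp H 2 μ) (x : X) :
    fullRange X ℓ²(I, ℂ) x →L[ℂ] fullRange X ℓ²(I, ℂ) x :=
  fiberAnalysis φ x ∘L (fiberAnalysis φ x).adjoint

end Systems

end MIFrames

end

open MIFrames

namespace MIFrames

/-! ### Range functions: closedness of V_J and measurability of J. -/

section RangeFunctions

variable {X Y I H : Type*} [MeasurableSpace X] {μ : Measure X}
  [NormedAddCommGroup H] [InnerProductSpace ℂ H]

/-! Everything rests on one identity: the pairing of ψ with g_t φ_i is the integral of the scalar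
function x ↦ ⟨ψ(x), φ_i(x)⟩ against conj(g_t) (`inner_smul_left_eq_integral`). This function is in
L¹ by Cauchy–Schwarz, and it is the i-th coordinate of T̃(x)ψ(x). The Parseval identity therefore
trades integrals over Y for integrals over X.

This has three consequences. A vector of V_J orthogonal to S(𝒜) has all these scalar functions zero,
hence is zero, so S(𝒜) = V_J (`genSpace_eq_rangeSpace`). The global Bessel bound, tested on vectors
1_s v, localizes to the same bound B on almost every fiber (`ae_forall_tsum_inner_le`). Once the
fibers are Bessel, the scalar functions are also in L², so the pairings are their Plancherel
transforms and T = F_I A with A = ∫^⊕ T̃(x) (`analysis_eq_plancherelI`).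

The rest is algebra: F_I is an isometry and direct integrals respect adjoints and products, so T*T =
A*A and F_I* TT* F_I = AA*. Direct integrals commute with multiplications, which gives
multiplication invariance. -/

lemma isClosed_rangeSpace (J : X → Submodule ℂ H) (hJ : ∀ x, IsClosed (J x : Set H)) :
    IsClosed (rangeSpace μ J : Set (Lp H 2 μ)) := by
  refine IsSeqClosed.isClosed fun f ψ hf hψ => ?_
  -- L² convergence gives a.e. convergence along a subsequence, so closedness can be used fiber by
  -- fiber.
  obtain ⟨n, -, hn⟩ := (tendstoInMeasure_of_tendsto_Lp hψ).exists_seq_tendsto_ae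
  have hf' : ∀ᵐ x ∂μ, ∀ k, f k x ∈ J x := ae_all_iff.2 hf
  change ∀ᵐ x ∂μ, ψ x ∈ J x
  filter_upwards [hn, hf'] with x hx h
  exact (hJ x).mem_of_tendsto hx (.of_forall fun k => h (n k))

lemma isClosed_genRange (φ : I → Lp H 2 μ) (x : X) : IsClosed (genRange φ x : Set H) :=
  Submodule.isClosed_topologicalClosure _

lemma mem_genRange (φ : I → Lp H 2 μ) (x : X) (i : I) : φ i x ∈ genRange φ x :=
  (fiberSystem φ x i).2

lemma smul_mem_rangeSpace (J : X → Submodule ℂ H) (f : Lp ℂ ∞ μ) {ψ : Lp H 2 μ}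
    (hψ : ψ ∈ rangeSpace μ J) : (f • ψ : Lp H 2 μ) ∈ rangeSpace μ J := by
  have hψ' : ∀ᵐ x ∂μ, ψ x ∈ J x := hψ
  change ∀ᵐ x ∂μ, (f • ψ : Lp H 2 μ) x ∈ J x
  filter_upwards [hψ', Lp.coeFn_lpSMul (r := 2) f ψ] with x h1 h2
  rw [h2]
  exact (J x).smul_mem _ h1

lemma eq_zero_of_mem_genRange (φ : I → Lp H 2 μ) {x : X} {v : H} (hv : v ∈ genRange φ x)
    (h : ∀ i, inner ℂ (φ i x) v = 0) : v = 0 := by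
  have h1 : genRange φ x ≤ (ℂ ∙ v)ᗮ := by
    refine Submodule.topologicalClosure_minimal _ (Submodule.span_le.2 ?_)
      (Submodule.isClosed_orthogonal _)
    rintro _ ⟨i, rfl⟩
    exact Submodule.mem_orthogonal_singleton_iff_inner_left.2 (h i)
  exact inner_self_eq_zero.1 (Submodule.mem_orthogonal_singleton_iff_inner_left.1 (h1 hv))

lemma isClosed_genSpace (g : Y → Lp ℂ ∞ μ) (φ : I → Lp H 2 μ) :
    IsClosed (genSpace g φ : Set (Lp H 2 μ)) :=
  Submodule.isClosed_topologicalClosure _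

variable [CompleteSpace H]

/-- The projection realizes the distance from u to J(x), and that distance is approached by finite
combinations with coefficients from a countable dense set. The condition becomes a countable union
of conditions measurable in x. -/
lemma norm_sub_proj_lt_iff [Countable I] (φ : I → Lp H 2 μ) (u : H) (x : X) (r : ℝ) :
    ‖u - (genRange φ x).orthogonalProjectionOnto u‖ < r ↔
      ∃ (s : Finset I) (n : ℕ),
        ‖u - ∑ i ∈ s, TopologicalSpace.denseSeq (I → ℂ) n i • φ i x‖ < r := by
  constructor
  · intro h
    have h1 : ((genRange φ x).orthogonalProjectionOnto u : H) ∈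
        closure (Submodule.span ℂ (Set.range fun i => φ i x) : Set H) :=
      ((genRange φ x).orthogonalProjectionOnto u).2
    obtain ⟨y, hy, hyd⟩ := Metric.mem_closure_iff.1 h1 _ (sub_pos.2 h)
    obtain ⟨c, rfl⟩ := Finsupp.mem_span_range_iff_exists_finsupp.1 hy
    have h2 : ‖u - ∑ i ∈ c.support, c i • φ i x‖ < r := by
      rw [dist_eq_norm] at hyd
      have h3 := norm_add_le (u - ((genRange φ x).orthogonalProjectionOnto u : H))
        (((genRange φ x).orthogonalProjectionOnto u : H) - c.sum fun i a => a • φ i x)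
      rw [sub_add_sub_cancel] at h3
      exact h3.trans_lt (by linarith)
    -- Only finitely many coordinates of a enter, so the condition is open in the product topology
    -- and a dense sequence meets it.
    have h4 : IsOpen {a : I → ℂ | ‖u - ∑ i ∈ c.support, a i • φ i x‖ < r} :=
      isOpen_lt (by fun_prop) continuous_const
    obtain ⟨_, h5, n, rfl⟩ :=
      (TopologicalSpace.denseRange_denseSeq (I → ℂ)).inter_open_nonempty _ h4 ⟨c, h2⟩
    exact ⟨c.support, n, h5⟩
  · rintro ⟨s, n, h⟩
    refine lt_of_le_of_lt ?_ h
    have h1 := (genRange φ x).starProjection_minimal u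
    rw [Submodule.starProjection_apply] at h1
    rw [h1]
    exact ciInf_le ⟨0, by rintro _ ⟨w, rfl⟩; exact norm_nonneg _⟩
      (⟨_, Submodule.sum_mem _ fun i _ => Submodule.smul_mem _ _ (mem_genRange φ x i)⟩ :
        genRange φ x)

lemma measurable_norm_sub_proj [Countable I] (φ : I → Lp H 2 μ) (u : H) :
    Measurable fun x => ‖u - (genRange φ x).orthogonalProjectionOnto u‖ := by
  refine measurable_of_Iio fun r => ?_
  have h : (fun x => ‖u - (genRange φ x).orthogonalProjectionOnto u‖) ⁻¹' Set.Iio r =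
      ⋃ (s : Finset I) (n : ℕ),
        {x | ‖u - ∑ i ∈ s, TopologicalSpace.denseSeq (I → ℂ) n i • φ i x‖ < r} := by
    ext x
    simpa using norm_sub_proj_lt_iff φ u x r
  rw [h]
  refine .iUnion fun s => .iUnion fun n => measurableSet_lt ?_ measurable_const
  exact (stronglyMeasurable_const.sub (Finset.stronglyMeasurable_fun_sum _ fun i _ =>
    (Lp.stronglyMeasurable (φ i)).const_smul _)).norm.measurable

/-- The range function generated by countably many elements of `L²(X; H)` is measurable. -/
lemma isMeasurableRange_genRange [Countable I] (φ : I → Lp H 2 μ) :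
    IsMeasurableRange (genRange φ) := by
  -- The quadratic form is ‖Pu‖² = ‖u‖² - dist(u, J(x))²; polarization then recovers the
  -- sesquilinear form.
  have h1 : ∀ u : H, Measurable fun x => inner ℂ ((genRange φ x).starProjection u) u := by
    intro u
    have h2 : ∀ x, inner ℂ ((genRange φ x).starProjection u) u =
        ((‖u‖ ^ 2 - ‖u - (genRange φ x).orthogonalProjectionOnto u‖ ^ 2 : ℝ) : ℂ) := by
      intro x
      have h3 := (genRange φ x).norm_sq_eq_add_norm_sq_starProjection u
      have h4 := Submodule.inner_orthogonalProjectionOnto_eq_of_mem_left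
        ((genRange φ x).orthogonalProjectionOnto u) u
      rw [Submodule.starProjection_orthogonal_val, Submodule.starProjection_apply] at h3
      rw [h3, add_sub_cancel_right, Submodule.starProjection_apply, ← h4,
        inner_self_eq_norm_sq_to_K]
      push_cast
      rfl
    simp_rw [h2]
    exact Complex.measurable_ofReal.comp
      (measurable_const.sub ((measurable_norm_sub_proj φ u).pow_const 2))
  intro u v
  have h4 : ∀ x, inner ℂ v ((genRange φ x).orthogonalProjectionOnto u : H) =
      inner ℂ ((genRange φ x).starProjection v) u := by
    intro x
    rw [Submodule.inner_starProjection_left_eq_right, Submodule.starProjection_apply]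
  have h5 := fun x => inner_map_polarization ((genRange φ x).starProjection : H →ₗ[ℂ] H) u v
  simp only [ContinuousLinearMap.coe_coe] at h5
  simp_rw [h4, h5]
  exact (((((h1 _).sub (h1 _)).add ((h1 _).const_mul _)).sub ((h1 _).const_mul _)).div_const 4)

end RangeFunctions

/-! ### Parseval on fibers: S(𝒜) = V_J and the fiberwise Bessel bound. -/

section Parseval

variable {X Y I H : Type*} [MeasurableSpace X] {μ : Measure X} [MeasurableSpace Y] {ν : Measure Y}
  [NormedAddCommGroup H] [InnerProductSpace ℂ H] {g : Y → Lp ℂ ∞ μ}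

lemma inner_smul_left_eq_integral (f : Lp ℂ ∞ μ) (φ ψ : Lp H 2 μ) :
    inner ℂ (f • φ : Lp H 2 μ) ψ = ∫ x, inner ℂ (φ x) (ψ x) * conj (f x) ∂μ := by
  rw [L2.inner_def]
  refine integral_congr_ae ?_
  filter_upwards [Lp.coeFn_lpSMul (r := 2) f φ] with x hx
  rw [hx, Pi.smul_apply', inner_smul_left, mul_comm]

/-- The fiberwise inner product is integrable but need not be square-integrable, so the Parseval
identity is used in its extended form, where both sides may be infinite. -/
lemma IsParsevalDeterminingSet.lintegral_inner_smul (hg : IsParsevalDeterminingSet μ ν g)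
    (φ ψ : Lp H 2 μ) :
    ∫⁻ t, ‖inner ℂ (g t • φ : Lp H 2 μ) ψ‖ₑ ^ 2 ∂ν = ∫⁻ x, ‖inner ℂ (φ x) (ψ x)‖ₑ ^ 2 ∂μ := by
  simp_rw [inner_smul_left_eq_integral]
  exact hg.parseval _ (L2.integrable_inner φ ψ)

/-- For ψ in V_J, the component η orthogonal to S(𝒜) stays in V_J. Its pairings with all g_t φ_i
vanish, so Parseval makes η(x) orthogonal to every φ_i(x), off one null set because I is countable.
Since η(x) lies in their closed span, η = 0. -/
lemma genSpace_eq_rangeSpace [Countable I] [CompleteSpace H]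
    (hg : IsParsevalDeterminingSet μ ν g) (φ : I → Lp H 2 μ) :
    genSpace g φ = rangeSpace μ (genRange φ) := by
  have hle : genSpace g φ ≤ rangeSpace μ (genRange φ) := by
    refine Submodule.topologicalClosure_minimal _ (Submodule.span_le.2 ?_)
      (isClosed_rangeSpace _ (isClosed_genRange φ))
    rintro _ ⟨z, rfl⟩
    exact smul_mem_rangeSpace _ _
      (show ∀ᵐ x ∂μ, φ z.2 x ∈ genRange φ x from .of_forall fun x => mem_genRange φ x z.2)
  refine hle.antisymm fun ψ hψ => ?_
  set η : Lp H 2 μ := ψ - (genSpace g φ).starProjection ψ with hη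
  have hηJ : ∀ᵐ x ∂μ, η x ∈ genRange φ x :=
    (rangeSpace μ (genRange φ)).sub_mem hψ (hle (Submodule.starProjection_apply_mem _ _))
  have h0 : ∀ᵐ x ∂μ, ∀ i, inner ℂ (φ i x) (η x) = 0 := by
    refine ae_all_iff.2 fun i => ?_
    have h1 := hg.lintegral_inner_smul (φ i) η
    have h2 : ∀ t, inner ℂ (g t • φ i : Lp H 2 μ) η = 0 := fun t =>
      Submodule.inner_right_of_mem_orthogonal (multSystem g φ (t, i)).2
        (Submodule.sub_starProjection_mem_orthogonal ψ)
    simp only [h2, enorm_zero, ne_eq, OfNat.ofNat_ne_zero, not_false_eq_true, zero_pow,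
      lintegral_zero] at h1
    have h3 := (lintegral_eq_zero_iff' (((L2.integrable_inner (𝕜 := ℂ)
      (φ i) η).aestronglyMeasurable.enorm.pow_const 2))).1 h1.symm
    filter_upwards [h3] with x hx
    simpa using hx
  have hη0 : η = 0 := by
    refine (Lp.eq_zero_iff_ae_eq_zero).2 ?_
    filter_upwards [hηJ, h0] with x h1 h2
    exact eq_zero_of_mem_genRange φ h1 h2
  rw [sub_eq_zero.1 (hη.symm.trans hη0)]
  exact Submodule.starProjection_apply_mem _ _

variable [MeasurableSpace I] [DiscreteMeasurableSpace I] [Countable I] [SFinite ν]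
  [CompleteSpace H]

/-- Projecting ψ onto S(𝒜) preserves its pairings with the system and does not increase its norm.
The bound is thus available for test vectors 1_s v, which need not lie in S(𝒜). -/
lemma tsum_lintegral_inner_le (hg : IsParsevalDeterminingSet μ ν g) {φ : I → Lp H 2 μ} {B : ℝ}
    (hB : 0 < B)
    (hE : IsBesselWith B (ν.prod (Measure.count : Measure I)) (multSystem g φ)) (ψ : Lp H 2 μ) :
    ∑' i, ∫⁻ x, ‖inner ℂ (φ i x) (ψ x)‖ₑ ^ 2 ∂μ ≤ ENNReal.ofReal (B * ‖ψ‖ ^ 2) := by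
  set η := (genSpace g φ).orthogonalProjectionOnto ψ
  have h1 : ∀ z : Y × I, inner ℂ (multSystem g φ z) η = inner ℂ (g z.1 • φ z.2 : Lp H 2 μ) ψ :=
    fun z => Submodule.inner_orthogonalProjectionOnto_eq_of_mem_left (multSystem g φ z) ψ
  have h2 := hE.2 η
  rw [lintegral_prod_count ((hE.1 η).enorm.pow_const 2)] at h2
  simp only [h1, hg.lintegral_inner_smul] at h2
  refine h2.trans (ENNReal.ofReal_le_ofReal ?_)
  gcongr
  exact Submodule.norm_orthogonalProjectionOnto_apply_le _ _

variable [SigmaFinite μ]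

/-- Testing on 1_s v bounds the integral of the sum over s by B‖v‖² μ(s). As s runs over all sets of
finite measure, σ-finiteness turns this into a pointwise bound. -/
lemma ae_tsum_inner_le (hg : IsParsevalDeterminingSet μ ν g) {φ : I → Lp H 2 μ} {B : ℝ}
    (hB : 0 < B)
    (hE : IsBesselWith B (ν.prod (Measure.count : Measure I)) (multSystem g φ)) (v : H) :
    ∀ᵐ x ∂μ, ∑' i, ‖inner ℂ (φ i x) v‖ₑ ^ 2 ≤ ENNReal.ofReal (B * ‖v‖ ^ 2) := by
  have hm : ∀ i, Measurable fun x => ‖inner ℂ (φ i x) v‖ₑ ^ 2 := fun i =>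
    ((Lp.stronglyMeasurable (φ i)).inner stronglyMeasurable_const).enorm.pow_const 2
  refine ae_le_of_forall_setLIntegral_le_of_sigmaFinite (Measurable.tsum hm)
    fun s hs hμs => ?_
  have h1 := tsum_lintegral_inner_le hg hB hE (indicatorConstLp 2 hs hμs.ne v)
  have h2 : ∀ i, ∫⁻ x, ‖inner ℂ (φ i x) (indicatorConstLp 2 hs hμs.ne v x)‖ₑ ^ 2 ∂μ =
      ∫⁻ x in s, ‖inner ℂ (φ i x) v‖ₑ ^ 2 ∂μ := by
    intro i
    rw [← lintegral_indicator hs]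
    refine lintegral_congr_ae ?_
    filter_upwards [indicatorConstLp_coeFn (p := 2) (hs := hs) (hμs := hμs.ne) (c := v)] with x hx
    rw [hx]
    by_cases hxs : x ∈ s <;> simp [hxs]
  rw [lintegral_tsum fun i => (hm i).aemeasurable, setLIntegral_const]
  simp_rw [h2] at h1
  refine h1.trans_eq ?_
  rw [norm_indicatorConstLp (by norm_num) (by norm_num), mul_pow]
  have h3 : (μ.real s ^ (1 / (2 : ℝ≥0∞).toReal)) ^ 2 = μ.real s := by
    rw [ENNReal.toReal_ofNat, ← Real.sqrt_eq_rpow, Real.sq_sqrt measureReal_nonneg]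
  rw [h3, ← mul_assoc, ENNReal.ofReal_mul (by positivity), Measure.real,
    ENNReal.ofReal_toReal hμs.ne]

variable [TopologicalSpace.SeparableSpace H]

/-- The null set for a single v depends on v; a countable dense set of vectors has a common one. The
bound passes to all v through finite partial sums, which are continuous in v, whereas the full
series is only known to be their supremum. -/
lemma ae_forall_tsum_inner_le (hg : IsParsevalDeterminingSet μ ν g) {φ : I → Lp H 2 μ} {B : ℝ}
    (hB : 0 < B)
    (hE : IsBesselWith B (ν.prod (Measure.count : Measure I)) (multSystem g φ)) :
    ∀ᵐ x ∂μ, ∀ v : H, ∑' i, ‖inner ℂ (φ i x) v‖ₑ ^ 2 ≤ ENNReal.ofReal (B * ‖v‖ ^ 2) := by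
  have h1 : ∀ᵐ x ∂μ, ∀ n, ∑' i, ‖inner ℂ (φ i x) (TopologicalSpace.denseSeq H n)‖ₑ ^ 2 ≤
      ENNReal.ofReal (B * ‖TopologicalSpace.denseSeq H n‖ ^ 2) :=
    ae_all_iff.2 fun n => ae_tsum_inner_le hg hB hE _
  filter_upwards [h1] with x hx v
  rw [ENNReal.tsum_eq_iSup_sum]
  refine iSup_le fun s => ?_
  refine (TopologicalSpace.denseRange_denseSeq H).induction_on
    (p := fun v => ∑ i ∈ s, ‖inner ℂ (φ i x) v‖ₑ ^ 2 ≤ ENNReal.ofReal (B * ‖v‖ ^ 2)) v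
    (isClosed_le ?_ (ENNReal.continuous_ofReal.comp (by fun_prop))) fun n => (ENNReal.sum_le_tsum s).trans (hx n)
  refine continuous_finsetSum _ fun i _ => ?_
  have h2 : Continuous fun v : H => ‖inner ℂ (φ i x) v‖ₑ := by fun_prop
  exact (ENNReal.continuous_pow 2).comp h2

/-- That B is the same on almost every fiber is what later makes x ↦ T̃(x) essentially bounded. -/
lemma ae_isBesselWith_fiberSystem (hg : IsParsevalDeterminingSet μ ν g) {φ : I → Lp H 2 μ} {B : ℝ}
    (hB : 0 < B)
    (hE : IsBesselWith B (ν.prod (Measure.count : Measure I)) (multSystem g φ)) :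
    ∀ᵐ x ∂μ, IsBesselWith B (Measure.count : Measure I) (fiberSystem φ x) := by
  filter_upwards [ae_forall_tsum_inner_le hg hB hE] with x hx
  refine ⟨fun v => .of_discrete, fun v => ?_⟩
  rw [lintegral_count]
  exact hx v

end Parseval

end MIFrames

namespace MIFrames

/-! ### Calculus of direct integrals: multiplications, products, adjoints. -/

section DirectIntegrals

variable {X H H' H'' : Type*} [MeasurableSpace X] {μ : Measure X}
  [NormedAddCommGroup H] [InnerProductSpace ℂ H] [CompleteSpace H]
  [TopologicalSpace.SeparableSpace H]
  [NormedAddCommGroup H'] [InnerProductSpace ℂ H'] [CompleteSpace H']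
  [TopologicalSpace.SeparableSpace H']
  [NormedAddCommGroup H''] [InnerProductSpace ℂ H''] [CompleteSpace H'']
  [TopologicalSpace.SeparableSpace H'']
  {J : X → Submodule ℂ H} {J' : X → Submodule ℂ H'} {J'' : X → Submodule ℂ H''}
  [∀ x, CompleteSpace (J x)] [∀ x, CompleteSpace (J' x)] [∀ x, CompleteSpace (J'' x)]

-- On each fiber f acts as the scalar f(x), which the linear map R(x) lets through; this is the
-- source of multiplication invariance.
omit [∀ x, CompleteSpace (J' x)] in
lemma directIntegral_smul {R : ∀ x, J x →L[ℂ] J' x} (hR : IsBoundedMeasurable μ R) (f : Lp ℂ ∞ μ)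
    (φ : rangeSpace μ J) :
    (directIntegral R hR ⟨f • (φ : Lp H 2 μ), smul_mem_rangeSpace J f φ.2⟩ : Lp H' 2 μ) =
      f • (directIntegral R hR φ : Lp H' 2 μ) := by
  refine Lp.ext ?_
  filter_upwards [directIntegral_ae R hR φ,
    directIntegral_ae R hR ⟨f • (φ : Lp H 2 μ), smul_mem_rangeSpace J f φ.2⟩,
    Lp.coeFn_lpSMul (r := 2) f (φ : Lp H 2 μ),
    Lp.coeFn_lpSMul (r := 2) f (directIntegral R hR φ : Lp H' 2 μ)] with x h1 h2 h3 h4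
  obtain ⟨m1, h1⟩ := h1
  obtain ⟨m2, h2⟩ := h2
  rw [h2, h4, Pi.smul_apply', h1, ← Submodule.coe_smul, ← map_smul]
  congr 2
  exact Subtype.ext h3

omit [∀ x, CompleteSpace (J'' x)] in
lemma directIntegral_comp {R : ∀ x, J x →L[ℂ] J' x} {Q : ∀ x, J' x →L[ℂ] J'' x}
    (hR : IsBoundedMeasurable μ R) (hQ : IsBoundedMeasurable μ Q)
    (hQR : IsBoundedMeasurable μ fun x => Q x ∘L R x) (φ : rangeSpace μ J) :
    directIntegral _ hQR φ = directIntegral Q hQ (directIntegral R hR φ) := by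
  refine Subtype.ext (Lp.ext ?_)
  filter_upwards [directIntegral_ae R hR φ, directIntegral_ae _ hQR φ,
    directIntegral_ae Q hQ (directIntegral R hR φ)] with x h1 h2 h3
  obtain ⟨m1, h1⟩ := h1
  obtain ⟨m2, h2⟩ := h2
  obtain ⟨m3, h3⟩ := h3
  rw [h2, h3, ContinuousLinearMap.comp_apply]
  congr 2
  exact Subtype.ext h1.symm

/-- The L² inner product integrates the fiber inner products, so the adjoint can be moved across on
each fiber. -/
lemma inner_directIntegral_adjoint {R : ∀ x, J x →L[ℂ] J' x} (hR : IsBoundedMeasurable μ R)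
    (hR' : IsBoundedMeasurable μ fun x => (R x).adjoint)
    (φ : rangeSpace μ J) (ψ : rangeSpace μ J') :
    inner ℂ φ (directIntegral _ hR' ψ) = inner ℂ (directIntegral R hR φ) ψ := by
  rw [Submodule.coe_inner, Submodule.coe_inner, L2.inner_def, L2.inner_def]
  refine integral_congr_ae ?_
  filter_upwards [directIntegral_ae R hR φ, directIntegral_ae _ hR' ψ] with x h1 h2
  obtain ⟨m1, h1⟩ := h1
  obtain ⟨m2, h2⟩ := h2
  rw [h1, h2]
  exact (R x).adjoint_inner_right ⟨_, m1⟩ ⟨_, m2⟩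

omit [CompleteSpace H] [TopologicalSpace.SeparableSpace H] [CompleteSpace H']
  [TopologicalSpace.SeparableSpace H'] in
/-- Boundedness and measurability pass to the adjoint range operator. -/
lemma IsBoundedMeasurable.adjoint {R : ∀ x, J x →L[ℂ] J' x} (hR : IsBoundedMeasurable μ R) :
    IsBoundedMeasurable μ fun x => (R x).adjoint := by
  refine ⟨?_, fun u v => ?_⟩
  · refine lt_of_eq_of_lt ?_ hR.bounded
    congr 1
    funext x
    rw [← ofReal_norm, ← ofReal_norm, LinearIsometryEquiv.norm_map]
  -- A matrix coefficient of the adjoint is the conjugate of one of R, with u and v exchanged.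
  · have h : ∀ x, inner ℂ v ((R x).adjoint ((J' x).orthogonalProjectionOnto u) : H) =
        conj (inner ℂ u (R x ((J x).orthogonalProjectionOnto v) : H')) := by
      intro x
      rw [inner_conj_symm, ← Submodule.inner_orthogonalProjectionOnto_eq_of_mem_right,
        ← Submodule.inner_orthogonalProjectionOnto_eq_of_mem_left,
        ContinuousLinearMap.adjoint_inner_right]
    simp_rw [h]
    exact Complex.continuous_conj.measurable.comp (hR.measurable v u)

-- Moving Q(x) to the other side as its adjoint writes a coefficient of the product as the inner
-- product of two H'-valued functions. Both are weakly, hence (H' being separable) strongly,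
-- measurable.
omit [CompleteSpace H] [TopologicalSpace.SeparableSpace H] [CompleteSpace H'']
  [TopologicalSpace.SeparableSpace H''] in
lemma IsBoundedMeasurable.comp {R : ∀ x, J x →L[ℂ] J' x} {Q : ∀ x, J' x →L[ℂ] J'' x}
    (hQ : IsBoundedMeasurable μ Q) (hR : IsBoundedMeasurable μ R) :
    IsBoundedMeasurable μ fun x => Q x ∘L R x := by
  refine ⟨?_, fun u v => ?_⟩
  · refine lt_of_le_of_lt (essSup_le_of_ae_le
      (essSup (fun x => ‖Q x‖ₑ) μ * essSup (fun x => ‖R x‖ₑ) μ) ?_)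
      (ENNReal.mul_lt_top hQ.bounded hR.bounded)
    filter_upwards [ENNReal.ae_le_essSup (fun x => ‖Q x‖ₑ),
      ENNReal.ae_le_essSup (fun x => ‖R x‖ₑ)] with x h1 h2
    refine le_trans ?_ (mul_le_mul' h1 h2)
    rw [← ofReal_norm, ← ofReal_norm, ← ofReal_norm, ← ENNReal.ofReal_mul (norm_nonneg _)]
    exact ENNReal.ofReal_le_ofReal ((Q x).opNorm_comp_le (R x))
  · have h1 : StronglyMeasurable fun x => (R x ((J x).orthogonalProjectionOnto u) : H') :=
      stronglyMeasurable_of_weakly (hR.measurable u)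
    have h2 : StronglyMeasurable
        fun x => ((Q x).adjoint ((J'' x).orthogonalProjectionOnto v) : H') :=
      stronglyMeasurable_of_weakly (hQ.adjoint.measurable v)
    have h : ∀ x, inner ℂ v ((Q x ∘L R x) ((J x).orthogonalProjectionOnto u) : H'') =
        inner ℂ ((Q x).adjoint ((J'' x).orthogonalProjectionOnto v) : H')
          (R x ((J x).orthogonalProjectionOnto u) : H') := by
      intro x
      rw [← Submodule.coe_inner, ContinuousLinearMap.adjoint_inner_left,
        Submodule.inner_orthogonalProjectionOnto_eq_of_mem_right]
      rfl
    simp_rw [h]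
    exact (h2.inner h1).measurable

end DirectIntegrals

/-! ### Fiber analysis operators and the factorization of T. -/

section Fibers

variable {X Y I H : Type*} [MeasurableSpace X] {μ : Measure X} [MeasurableSpace Y] {ν : Measure Y}
  [NormedAddCommGroup H] [InnerProductSpace ℂ H] [CompleteSpace H]
  [TopologicalSpace.SeparableSpace H]
  [MeasurableSpace I] [DiscreteMeasurableSpace I]

omit [CompleteSpace H] [TopologicalSpace.SeparableSpace H] in
lemma fiberAnalysis_apply {φ : I → Lp H 2 μ} {x : X}
    (h : IsBessel (Measure.count : Measure I) (fiberSystem φ x)) (v : genRange φ x) (i : I) :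
    (fiberAnalysis φ x v : ℓ²(I, ℂ)) i = inner ℂ (φ i x) (v : H) := by
  rw [fiberAnalysis, dif_pos h]
  rfl

omit [CompleteSpace H] [TopologicalSpace.SeparableSpace H] in
lemma enorm_fiberAnalysis_le {φ : I → Lp H 2 μ} {x : X} {B : ℝ} (hB : 0 < B)
    (h : IsBesselWith B (Measure.count : Measure I) (fiberSystem φ x)) :
    ‖fiberAnalysis φ x‖ₑ ≤ ENNReal.ofReal √B := by
  rw [← ofReal_norm]
  refine ENNReal.ofReal_le_ofReal (ContinuousLinearMap.opNorm_le_bound _ (by positivity)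
    fun v => norm_le_sqrt_mul hB ?_)
  have h1 : ‖fiberAnalysis φ x v‖ₑ ^ 2 = ∑' i, ‖inner ℂ (φ i x) (v : H)‖ₑ ^ 2 :=
    (lp_enorm_sq (fiberAnalysis φ x v : ℓ²(I, ℂ))).trans
      (tsum_congr fun i => congrArg (‖·‖ₑ ^ 2) (fiberAnalysis_apply ⟨B, hB, h⟩ v i))
  rw [h1, ← lintegral_count]
  exact h.2 v

variable [Countable I]

-- The uniform Bessel bound gives ‖T̃(x)‖ ≤ √B a.e. Because T̃ is set to 0 at non-Bessel points, its
-- coefficients agree only a.e. with a measurable series; completeness of μ makes them measurable.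
omit [TopologicalSpace.SeparableSpace H] in
lemma isBoundedMeasurable_fiberAnalysis [μ.IsComplete] {φ : I → Lp H 2 μ} {B : ℝ} (hB : 0 < B)
    (h : ∀ᵐ x ∂μ, IsBesselWith B (Measure.count : Measure I) (fiberSystem φ x)) :
    IsBoundedMeasurable μ (fiberAnalysis φ) := by
  refine ⟨?_, fun u v => ?_⟩
  · refine lt_of_le_of_lt (essSup_le_of_ae_le (ENNReal.ofReal √B) ?_) ENNReal.ofReal_lt_top
    filter_upwards [h] with x hx using enorm_fiberAnalysis_le hB hx
  · have h1 : ∀ᵐ x ∂μ, inner ℂ v (fiberAnalysis φ x ((genRange φ x).orthogonalProjectionOnto u) :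
        ℓ²(I, ℂ)) = ∑' i, inner ℂ (v i) (inner ℂ (φ i x) u) := by
      filter_upwards [h] with x hx
      rw [lp.inner_eq_tsum]
      refine tsum_congr fun i => ?_
      rw [fiberAnalysis_apply ⟨B, hB, hx⟩]
      congr 1
      exact Submodule.inner_orthogonalProjectionOnto_eq_of_mem_left (fiberSystem φ x i) u
    have h2 : Measurable fun x => ∑' i, inner ℂ (v i) (inner ℂ (φ i x) u) :=
      Measurable.tsum fun i => (stronglyMeasurable_const.inner
        ((Lp.stronglyMeasurable (φ i)).inner stronglyMeasurable_const)).measurable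
    exact (h2.aemeasurable.congr (EventuallyEq.symm h1)).nullMeasurable.measurable_of_complete

variable [SFinite ν] {g : Y → Lp ℂ ∞ μ}

/-- The i-th coordinate of T̃(x)ψ(x) is in L² as a coordinate of an element of L²(X; ℓ²(I)), and in
L¹ by Cauchy–Schwarz. Its Plancherel transform is therefore given by the integral formula, which is
the pairing of ψ with g_t φ_i. -/
lemma analysis_eq_plancherelI (hg : IsParsevalDeterminingSet μ ν g) (φ : I → Lp H 2 μ)
    (hE : IsBessel (ν.prod (Measure.count : Measure I)) (multSystem g φ))
    (hF : ∀ᵐ x ∂μ, IsBessel (Measure.count : Measure I) (fiberSystem φ x))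
    (hT : IsBoundedMeasurable μ (fiberAnalysis φ)) (ψ : genSpace g φ)
    (hψ : (ψ : Lp H 2 μ) ∈ rangeSpace μ (genRange φ)) :
    hE.analysis ψ = hg.plancherelI I (directIntegral (fiberAnalysis φ) hT ⟨ψ, hψ⟩) := by
  set a : Lp ℓ²(I, ℂ) 2 μ := (directIntegral (fiberAnalysis φ) hT ⟨ψ, hψ⟩).1 with ha
  have h1 : ∀ i, coord i a =ᵐ[μ] fun x => inner ℂ (φ i x) ((ψ : Lp H 2 μ) x) := by
    intro i
    filter_upwards [coord_ae i a, directIntegral_ae (fiberAnalysis φ) hT ⟨ψ, hψ⟩, hF]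
      with x h2 h3 h4
    obtain ⟨m, h3⟩ := h3
    rw [h2, ha, h3, fiberAnalysis_apply h4]
  have h2 : ∀ i, hg.plancherel (coord i a) =ᵐ[ν]
      fun t => inner ℂ (g t • φ i : Lp H 2 μ) (ψ : Lp H 2 μ) := by
    intro i
    refine (hg.plancherel_ae _ ((integrable_congr (h1 i)).2
      (L2.integrable_inner (φ i) (ψ : Lp H 2 μ)))).trans (.of_forall fun t => ?_)
    simp only [inner_smul_left_eq_integral]
    refine integral_congr_ae ?_
    filter_upwards [h1 i] with x hx
    rw [hx]
  refine Lp.ext ((hE.analysis_ae ψ).trans (EventuallyEq.trans ?_ (hg.plancherelI_ae a).symm))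
  refine ae_prod_count fun i => ?_
  filter_upwards [h2 i] with t ht
  rw [ht]
  rfl

end Fibers

end MIFrames

/-! ### Synthesis operator and Gramian under the Plancherel transform. -/

namespace MIFrames

lemma adjoint_apply_linearIsometry {E F : Type*} [NormedAddCommGroup E] [InnerProductSpace ℂ E]
    [CompleteSpace E] [NormedAddCommGroup F] [InnerProductSpace ℂ F] [CompleteSpace F]
    (U : E →ₗᵢ[ℂ] F) (x : E) : U.toContinuousLinearMap.adjoint (U x) = x :=
  ext_inner_left ℂ fun y => by
    rw [ContinuousLinearMap.adjoint_inner_right]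
    exact U.inner_map_map y x

section Operators

variable {X Y I H : Type*} [MeasurableSpace X] {μ : Measure X} [MeasurableSpace Y] {ν : Measure Y}
  [NormedAddCommGroup H] [InnerProductSpace ℂ H] [CompleteSpace H]
  [TopologicalSpace.SeparableSpace H] [SFinite ν]
  [MeasurableSpace I] [DiscreteMeasurableSpace I] [Countable I] {g : Y → Lp ℂ ∞ μ}

/-- With A = ∫^⊕ T̃(x), T = F_I A gives T* F_I = A* F_I* F_I = A*. Only the isometry property of F_I
is used, not surjectivity. -/
lemma synthesis_plancherelI (hg : IsParsevalDeterminingSet μ ν g) (φ : I → Lp H 2 μ)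
    (hE : IsBessel (ν.prod (Measure.count : Measure I)) (multSystem g φ))
    (hF : ∀ᵐ x ∂μ, IsBessel (Measure.count : Measure I) (fiberSystem φ x))
    (hV : genSpace g φ = rangeSpace μ (genRange φ))
    (hT : IsBoundedMeasurable μ (fiberAnalysis φ))
    (a : rangeSpace μ (fullRange X ℓ²(I, ℂ))) :
    (hE.synthesis (hg.plancherelI I a) : Lp H 2 μ) = directIntegral _ hT.adjoint a := by
  set b := directIntegral _ hT.adjoint a with hb
  suffices h : hE.synthesis (hg.plancherelI I a) = ⟨b, hV.ge b.2⟩ from congrArg Subtype.val h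
  refine ext_inner_left ℂ fun ψ => ?_
  have hψ : (ψ : Lp H 2 μ) ∈ rangeSpace μ (genRange φ) := hV ▸ ψ.2
  rw [IsBessel.synthesis, ContinuousLinearMap.adjoint_inner_right,
    analysis_eq_plancherelI hg φ hE hF hT ψ hψ, LinearIsometry.inner_map_map,
    ← Submodule.coe_inner, ← inner_directIntegral_adjoint hT hT.adjoint, ← hb]
  rfl

/-- F_I* T (T* F_I) = F_I* (F_I A) A* = AA*, and products of direct integrals are formed fiberwise.
-/
lemma adjoint_gramian_plancherelI (hg : IsParsevalDeterminingSet μ ν g) (φ : I → Lp H 2 μ)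
    (hE : IsBessel (ν.prod (Measure.count : Measure I)) (multSystem g φ))
    (hF : ∀ᵐ x ∂μ, IsBessel (Measure.count : Measure I) (fiberSystem φ x))
    (hV : genSpace g φ = rangeSpace μ (genRange φ))
    (hT : IsBoundedMeasurable μ (fiberAnalysis φ)) (hG : IsBoundedMeasurable μ (fiberGramian φ))
    (a : rangeSpace μ (fullRange X ℓ²(I, ℂ))) :
    (hg.plancherelI I).toContinuousLinearMap.adjoint (hE.gramian (hg.plancherelI I a)) =
      directIntegral (fiberGramian φ) hG a := by
  have h1 : hE.gramian (hg.plancherelI I a) = hg.plancherelI I (directIntegral (fiberAnalysis φ) hT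
      ⟨hE.synthesis (hg.plancherelI I a), hV.le (hE.synthesis (hg.plancherelI I a)).2⟩) :=
    analysis_eq_plancherelI hg φ hE hF hT (hE.synthesis (hg.plancherelI I a)) _
  have h2 : (⟨hE.synthesis (hg.plancherelI I a), hV.le (hE.synthesis (hg.plancherelI I a)).2⟩ :
      rangeSpace μ (genRange φ)) = directIntegral _ hT.adjoint a :=
    Subtype.ext (synthesis_plancherelI hg φ hE hF hV hT a)
  have h3 : directIntegral (fiberGramian φ) hG a =
      directIntegral (fiberAnalysis φ) hT (directIntegral _ hT.adjoint a) :=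
    directIntegral_comp hT.adjoint hT hG a
  rw [h1, h2, h3]
  exact adjoint_apply_linearIsometry _ _

end Operators

end MIFrames

/-! ### The main theorem. -/

theorem mainTheorem8 {X Y I H : Type*}
    [MeasurableSpace X] (μ : Measure X) [SigmaFinite μ] [μ.IsComplete]
    [TopologicalSpace.SeparableSpace (Lp ℂ 2 μ)]
    [MeasurableSpace Y] (ν : Measure Y) [SigmaFinite ν]
    [NormedAddCommGroup H] [InnerProductSpace ℂ H] [CompleteSpace H]
    [TopologicalSpace.SeparableSpace H]
    [Countable I] [MeasurableSpace I] [DiscreteMeasurableSpace I]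
    (g : Y → Lp ℂ ∞ μ) (hg : IsParsevalDeterminingSet μ ν g)
    (φ : I → Lp H 2 μ)
    (hE : IsBessel (ν.prod (Measure.count : Measure I)) (multSystem g φ)) :
    -- the range function `J` is measurable, and a.e. fiber system is Bessel
    IsMeasurableRange (genRange φ) ∧
    (∀ᵐ x ∂μ, IsBessel (Measure.count : Measure I) (fiberSystem φ x)) ∧
    -- `S(A) = V_J`, and the range operators of the theorem are bounded and measurable
    ∃ (hV : genSpace g φ = rangeSpace μ (genRange φ))
      (hT : IsBoundedMeasurable μ (fiberAnalysis φ))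
      (hS : IsBoundedMeasurable μ (fiberFrameOp φ))
      (hG : IsBoundedMeasurable μ (fiberGramian φ)),
      -- `T` maps into the image of `F_I`, and `T = F_I ∫^⊕ T̃(x) dμ(x)`
      (Set.range hE.analysis ⊆ Set.range (hg.plancherelI I)) ∧
      (∀ ψ : genSpace g φ, hE.analysis ψ =
        hg.plancherelI I (directIntegral (fiberAnalysis φ) hT ⟨ψ, hV ▸ ψ.2⟩)) ∧
      -- the frame operator is multiplication invariant, and `S = ∫^⊕ S(x) dμ(x)`
      IsMIOperator hE.frameOp ∧
      (∀ ψ : genSpace g φ, (hE.frameOp ψ : Lp H 2 μ) =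
        directIntegral (fiberFrameOp φ) hS ⟨ψ, hV ▸ ψ.2⟩) ∧
      -- `F_I* (T T*) F_I` is multiplication invariant, and equals `∫^⊕ T̃(x) T̃(x)* dμ(x)`
      (∀ (f : Lp ℂ ∞ μ) (a : Lp ℓ²(I, ℂ) 2 μ),
        (hg.plancherelI I).toContinuousLinearMap.adjoint
            (hE.gramian (hg.plancherelI I (f • a : Lp ℓ²(I, ℂ) 2 μ))) =
          (f • (hg.plancherelI I).toContinuousLinearMap.adjoint
            (hE.gramian (hg.plancherelI I a)) : Lp ℓ²(I, ℂ) 2 μ)) ∧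
      (∀ a : Lp ℓ²(I, ℂ) 2 μ,
        (hg.plancherelI I).toContinuousLinearMap.adjoint
            (hE.gramian (hg.plancherelI I a)) =
          directIntegral (fiberGramian φ) hG ⟨a, mem_rangeSpace_fullRange a⟩) := by
  obtain ⟨B, hB, hEB⟩ := id hE
  have hFB := ae_isBesselWith_fiberSystem hg hB hEB
  have hF : ∀ᵐ x ∂μ, IsBessel (Measure.count : Measure I) (fiberSystem φ x) :=
    hFB.mono fun x hx => ⟨B, hB, hx⟩
  have hV := genSpace_eq_rangeSpace hg φ
  have hT := isBoundedMeasurable_fiberAnalysis hB hFB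
  have hS : IsBoundedMeasurable μ (fiberFrameOp φ) := hT.adjoint.comp hT
  have hG : IsBoundedMeasurable μ (fiberGramian φ) := hT.comp hT.adjoint
  have hmem : ∀ ψ : genSpace g φ, (ψ : Lp H 2 μ) ∈ rangeSpace μ (genRange φ) :=
    fun ψ => hV ▸ ψ.2
  have hA : ∀ ψ : genSpace g φ, hE.analysis ψ =
      hg.plancherelI I (directIntegral (fiberAnalysis φ) hT ⟨ψ, hmem ψ⟩) :=
    fun ψ => analysis_eq_plancherelI hg φ hE hF hT ψ (hmem ψ)
  have hframe : ∀ ψ : genSpace g φ, (hE.frameOp ψ : Lp H 2 μ) =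
      directIntegral (fiberFrameOp φ) hS ⟨ψ, hmem ψ⟩ := fun ψ => by
    rw [IsBessel.frameOp, ContinuousLinearMap.comp_apply, hA,
      synthesis_plancherelI hg φ hE hF hV hT]
    exact congrArg Subtype.val (directIntegral_comp hT hT.adjoint hS ⟨ψ, hmem ψ⟩).symm
  have hgram : ∀ a : Lp ℓ²(I, ℂ) 2 μ,
      (hg.plancherelI I).toContinuousLinearMap.adjoint (hE.gramian (hg.plancherelI I a)) =
        directIntegral (fiberGramian φ) hG ⟨a, mem_rangeSpace_fullRange a⟩ := fun a =>
    adjoint_gramian_plancherelI hg φ hE hF hV hT hG ⟨a, mem_rangeSpace_fullRange a⟩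
  -- S(𝒜) is generated using the multipliers g_t only; invariance under all of L^∞ comes from its
  -- equality with V_J.
  have hMI : IsMISpace (genSpace g φ) :=
    ⟨isClosed_genSpace g φ, fun f ψ hψ => hV ▸ smul_mem_rangeSpace _ f (hmem ⟨ψ, hψ⟩)⟩
  refine ⟨isMeasurableRange_genRange φ, hF, hV, hT, hS, hG, ?_, hA,
    ⟨hMI, hMI, fun f ψ => ?_⟩, hframe, fun f a => ?_, hgram⟩
  · rintro _ ⟨ψ, rfl⟩
    exact ⟨_, (hA ψ).symm⟩
  · rw [hframe, hframe]
    exact directIntegral_smul hS f ⟨ψ, hmem ψ⟩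
  · rw [hgram, hgram]
    exact directIntegral_smul hG f ⟨a, mem_rangeSpace_fullRange a⟩
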